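/- Let $F_0=0$, $F_1=1$, $F_n=F_{n-1}+F_{n-2}$ be the Fibonacci numbers. Every natural number $n$ has a unique Fibonacci (Zeckendorf) representation as a sum of distinct, pairwise non-consecutive Fibonacci numbers $F_k$ with $k\ge 2$. The Fibonacci–Thue–Morse sequence $\mathbf{ftm}=(\mathbf{ftm}[n])_{n\ge 0}$ is defined by letting $\mathbf{ftm}[n]\in\{0,1\}$ be the sum modulo $2$ of the bits of this representation, i.e. the parity of the number of its summands. Let $\rho(n)$ be the subword complexity of $\mathbf{ftm}$, that is, the number of distinct contiguous blocks of length $n$ that appear in $\mathbf{ftm}$, and let $d(n):=\rho(n+1)-\rho(n)$. Then $$(d(n))_{n\ge 0} \;=\; (1,2,4,6,10)\,\prod_{i\ge 2} 6^{F_i+(-1)^i}\,8^{F_i},$$ where $\prod$ denotes concatenation (in order of increasing $i$) and the exponents denote repetition of the letters $6$ and $8$. -/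

import Mathlib

/-- The Fibonacci–Thue–Morse sequence: the sum modulo 2 of the bits of the Fibonacci (Zeckendorf)
representation of `n`. `Nat.zeckendorf n` is the list of the indices `k ≥ 2` of the non-consecutive
Fibonacci numbers `F_k` that sum to `n`, that is, of the positions of the bits `1`, so the sum of
the bits is its length. -/
def ftm (n : ℕ) : ZMod 2 := ((Nat.zeckendorf n).length : ZMod 2)

/-- The factor (contiguous block) of length `n` of the sequence `s` that starts at position `i`. -/
def factorAt {α : Type*} (s : ℕ → α) (n i : ℕ) : Fin n → α := fun t => s (i + t)

/-- The subword complexity of a sequence over a finite alphabet: the number of distinct factors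
of length `n`. The set of these factors is finite because the alphabet is. -/
noncomputable def subwordComplexity {α : Type*} [Finite α] (s : ℕ → α) (n : ℕ) : ℕ :=
  (Set.range (factorAt s n)).ncard

/-- The first difference `d(n) = ρ(n + 1) - ρ(n)` of the subword complexity `ρ` of the
Fibonacci–Thue–Morse sequence, computed in the integers. -/
noncomputable def ftmDiff (n : ℕ) : ℤ :=
  (subwordComplexity ftm (n + 1) : ℤ) - (subwordComplexity ftm n : ℤ)

/-- The concatenation `B 0 ++ B 1 ++ ⋯ ++ B (k - 1)` of the first `k` blocks. -/
def partialConcat {α : Type*} (B : ℕ → List α) (k : ℕ) : List α :=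
  (List.range k).flatMap B

/-- The infinite sequence `u` is the concatenation of the finite blocks `B 0, B 1, B 2, …`:
every finite partial concatenation is a prefix of `u`, and these prefixes exhaust `u`. -/
def IsInfiniteConcat {α : Type*} (u : ℕ → α) (B : ℕ → List α) : Prop :=
  (∀ k : ℕ, (List.range (partialConcat B k).length).map u = partialConcat B k) ∧
    ∀ n : ℕ, ∃ k : ℕ, n < (partialConcat B k).length

/-- The block `6^{F_i + (-1)^i} 8^{F_i}`, meant for `i ≥ 2`, where both exponents are
nonnegative. -/
def dekkingBlock (i : ℕ) : List ℤ :=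
  List.replicate ((Nat.fib i : ℤ) + (-1) ^ i).toNat 6 ++ List.replicate (Nat.fib i) 8

/-- The blocks `(1,2,4,6,10)`, then `6^{F_i + (-1)^i} 8^{F_i}` for `i = 2, 3, 4, …`. -/
def dekkingBlocks : ℕ → List ℤ
  | 0 => [1, 2, 4, 6, 10]
  | k + 1 => dekkingBlock (k + 2)

/-!
The sequence `ftm` is binary and each of its factors extends to the left, so `d(n)` is the number of
left special factors of length `n`, those preceded by both letters (`ftmDiff_eq_ncard`). Write `W_k`
for the prefix of `ftm` of length `F_k` and a bar for the binary complement; the Zeckendorf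
representation gives `W_{k+2} = W_{k+1} W̅_k`, and the language of `ftm` is closed under complement.

*Lower bound.* The two letters before position `F_p` run through all four binary words as `p` varies
modulo four. Hence all prefixes of `ftm`, `0 ftm`, `1 ftm` and their complements are left special,
so `d(n) ≥ 6` for `n ≥ 3` (`six_le_ftmDiff`). Moreover the word `W_k W̅_k`, lengthened to the left by
one suitable letter when `k` is even, is left special, because it occurs (up to complement) at
`F_{k+2}` and at `F_{k+1} + F_{k+3}`. It leaves `ftm` at position `F_{k+1}`, so it provides two more
left special factors for every length `n` with `F_{k+1} + τ < n ≤ 2 F_k + τ`, where `τ` is `1` for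
even `k` and `0` for odd `k` (`eight_le_ftmDiff`).

*Upper bound.* The sequence is a concatenation of blocks `W_k`, `W_{k-1}` and their complements, in
which a short block follows only the long block of opposite sign. So every factor of length `F_k` is,
up to complement, a window in `W_k W_k`, `W_k W̅_k`, `W_k W̅_{k-1} W̅_k` or `W̅_{k-1} W_k`
(`isPairWindow_ftmFactor`). After removing the coincidences between these windows there remain at
most `6 F_k + 2 F_{k-2} - 10` words, for `k ≥ 5` (`subwordComplexity_ftm_fib_le`).

Summed over `F_k ≤ n < F_{k+1}`, the lower bounds for `d(n)` account for the whole difference between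
the upper bounds at `F_k` and `F_{k+1}`, and the two bounds agree at `F_5 = 5`. Therefore each lower
bound is an equality (`ftmDiff_eq_value`, `ftmDiff_initial`), and the intervals on which `d` equals
`8` are the runs of `8` in the blocks `6^{F_i + (-1)^i} 8^{F_i}`, with `k = i + 2`.
-/

/-! ### Values of the sequence and its language -/

lemma add_one_add_one_zmod (x : ZMod 2) : x + 1 + 1 = x := by
  rw [add_assoc, CharTwo.add_self_eq_zero, add_zero]

lemma ftm_fib_add {k r : ℕ} (hk : 2 ≤ k) (hr : r < Nat.fib (k - 1)) :
    ftm (Nat.fib k + r) = ftm r + 1 := by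
  have hpos : 0 < Nat.fib k := Nat.fib_pos.2 (by omega)
  have hfib : Nat.fib (k + 1) = Nat.fib (k - 1) + Nat.fib k := by
    obtain ⟨m, rfl⟩ : ∃ m, k = m + 1 := ⟨k - 1, by omega⟩
    simpa using Nat.fib_add_two (n := m)
  have hg : Nat.greatestFib (Nat.fib k + r) = k := by
    apply le_antisymm
    · exact Nat.lt_succ_iff.1 (Nat.greatestFib_lt.2 (by rw [Nat.succ_eq_add_one]; omega))
    · exact Nat.le_greatestFib.2 (by omega)
  unfold ftm
  rw [Nat.zeckendorf_of_pos (by omega), hg]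
  simp

/-- The block of length `n` of the sequence `ftm` at position `i`, as a list. -/
def ftmFactor (i n : ℕ) : List (ZMod 2) := (List.range n).map fun t => ftm (i + t)

/-- The set of factors of length `n` of `ftm`, as lists. -/
def ftmLang (n : ℕ) : Set (List (ZMod 2)) := Set.range fun i => ftmFactor i n

/-- Addition of the constant `s` to every letter; for `s = 1` this is the binary complement. -/
def shiftWord (s : ZMod 2) (l : List (ZMod 2)) : List (ZMod 2) := l.map (· + s)

@[simp] lemma length_ftmFactor (i n : ℕ) : (ftmFactor i n).length = n := by simp [ftmFactor]

@[simp] lemma length_shiftWord (s : ZMod 2) (l : List (ZMod 2)) :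
    (shiftWord s l).length = l.length := by simp [shiftWord]

@[simp] lemma shiftWord_zero (l : List (ZMod 2)) : shiftWord 0 l = l := by simp [shiftWord]

@[simp] lemma shiftWord_nil (s : ZMod 2) : shiftWord s [] = [] := rfl

@[simp] lemma shiftWord_cons (s c : ZMod 2) (l : List (ZMod 2)) :
    shiftWord s (c :: l) = (c + s) :: shiftWord s l := rfl

@[simp] lemma shiftWord_append (s : ZMod 2) (l m : List (ZMod 2)) :
    shiftWord s (l ++ m) = shiftWord s l ++ shiftWord s m := by simp [shiftWord]

lemma shiftWord_shiftWord (s t : ZMod 2) (l : List (ZMod 2)) :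
    shiftWord s (shiftWord t l) = shiftWord (t + s) l := by
  simp [shiftWord, Function.comp_def, add_assoc]

lemma shiftWord_take (s : ZMod 2) (n : ℕ) (l : List (ZMod 2)) :
    shiftWord s (l.take n) = (shiftWord s l).take n := by simp [shiftWord, List.map_take]

lemma shiftWord_injective (s : ZMod 2) : Function.Injective (shiftWord s) :=
  List.map_injective_iff.2 (add_left_injective s)

lemma ftmFactor_add (i m n : ℕ) :
    ftmFactor i (m + n) = ftmFactor i m ++ ftmFactor (i + m) n := by
  simp [ftmFactor, List.range_add, Function.comp_def, add_assoc]

lemma ftmFactor_succ (i n : ℕ) : ftmFactor i (n + 1) = ftm i :: ftmFactor (i + 1) n := by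
  rw [add_comm n 1, ftmFactor_add]
  simp [ftmFactor]

lemma take_ftmFactor (i : ℕ) {m n : ℕ} (h : m ≤ n) :
    (ftmFactor i n).take m = ftmFactor i m := by
  obtain ⟨d, rfl⟩ := Nat.exists_eq_add_of_le h
  rw [ftmFactor_add, List.take_left' (by simp)]

/-- Adding a Fibonacci number that does not interact with the Zeckendorf representations of the
positions of a block complements this block. -/
lemma ftmFactor_fib_add {k i n : ℕ} (hk : 2 ≤ k) (h : i + n ≤ Nat.fib (k - 1)) :
    ftmFactor (Nat.fib k + i) n = shiftWord 1 (ftmFactor i n) := by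
  simp only [ftmFactor, shiftWord, List.map_map, Function.comp_def]
  refine List.map_congr_left fun t ht => ?_
  rw [List.mem_range] at ht
  rw [add_assoc, ftm_fib_add hk (by omega)]

lemma exists_le_fib (n : ℕ) : ∃ q, 5 ≤ q ∧ n ≤ Nat.fib q :=
  ⟨n + 5, by omega, by have := Nat.le_fib_self (n := n + 5) (by omega); omega⟩

lemma length_of_mem_ftmLang {n : ℕ} {l : List (ZMod 2)} (h : l ∈ ftmLang n) : l.length = n := by
  obtain ⟨i, rfl⟩ := h
  simp

lemma shiftWord_mem_ftmLang {n : ℕ} {l : List (ZMod 2)} (s : ZMod 2) (h : l ∈ ftmLang n) :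
    shiftWord s l ∈ ftmLang n := by
  obtain ⟨i, rfl⟩ := h
  have hs : s = 0 ∨ s = 1 := by revert s; decide
  obtain rfl | rfl := hs
  · exact ⟨i, by simp⟩
  · obtain ⟨q, hq, hn⟩ := exists_le_fib (i + n)
    exact ⟨Nat.fib (q + 1) + i, ftmFactor_fib_add (by omega) (by simpa using hn)⟩

lemma take_mem_ftmLang {n : ℕ} {l : List (ZMod 2)} (m : ℕ) (h : l ∈ ftmLang n) (hm : m ≤ n) :
    l.take m ∈ ftmLang m := by
  obtain ⟨i, rfl⟩ := h
  exact ⟨i, (take_ftmFactor i hm).symm⟩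

lemma tail_mem_ftmLang {n : ℕ} {c : ZMod 2} {l : List (ZMod 2)} (h : c :: l ∈ ftmLang (n + 1)) :
    l ∈ ftmLang n := by
  obtain ⟨i, hi⟩ := h
  simp only [ftmFactor_succ, List.cons.injEq] at hi
  exact ⟨i + 1, hi.2⟩

/-- The prefix of `ftm` recurs, complemented, at positive positions, so every factor can be extended
to the left. -/
lemma exists_cons_mem_ftmLang {n : ℕ} {l : List (ZMod 2)} (h : l ∈ ftmLang n) :
    ∃ c, c :: l ∈ ftmLang (n + 1) := by
  obtain ⟨i, rfl⟩ := h
  obtain ⟨q, hq, hn⟩ := exists_le_fib (i + n)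
  have hpos : 0 < Nat.fib (q + 1) := Nat.fib_pos.2 (by omega)
  have key := shiftWord_mem_ftmLang 1
    (Set.mem_range_self (f := fun i => ftmFactor i (n + 1)) (Nat.fib (q + 1) + i - 1))
  have e : Nat.fib (q + 1) + i - 1 + 1 = Nat.fib (q + 1) + i := by omega
  simp only [ftmFactor_succ, e] at key
  rw [ftmFactor_fib_add (by omega) (by simpa using hn), shiftWord_cons, shiftWord_shiftWord] at key
  exact ⟨_, by simpa [CharTwo.add_self_eq_zero] using key⟩

lemma ncard_ftmLang (n : ℕ) : (ftmLang n).ncard = subwordComplexity ftm n := by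
  have h : ftmLang n = List.ofFn '' Set.range (factorAt ftm n) := by
    rw [← Set.range_comp]
    unfold ftmLang
    congr 1
    funext i
    apply List.ext_getElem <;> simp [ftmFactor, factorAt]
  rw [h, Set.ncard_image_of_injective _ List.ofFn_injective, subwordComplexity]

lemma finite_ftmLang (n : ℕ) : (ftmLang n).Finite :=
  (List.finite_length_eq (ZMod 2) n).subset fun _ h => length_of_mem_ftmLang h

/-! ### Left special factors -/

/-- The left special factors of length `n`: those preceded by both letters. -/
def leftSpecial (n : ℕ) : Set (List (ZMod 2)) := {l | ∀ c, c :: l ∈ ftmLang (n + 1)}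

/-- Over a binary alphabet, removing the first letter maps the factors of length `n + 1` onto those
of length `n`, with two preimages exactly for the left special ones. -/
lemma ftmDiff_eq_ncard (n : ℕ) : ftmDiff n = (leftSpecial n).ncard := by
  have hA : ∀ c : ZMod 2, {l | c :: l ∈ ftmLang (n + 1)}.Finite := fun c =>
    (finite_ftmLang n).subset fun l hl => tail_mem_ftmLang hl
  have hz : ∀ c : ZMod 2, c = 0 ∨ c = 1 := by decide
  have hunion : ftmLang n =
      {l | 0 :: l ∈ ftmLang (n + 1)} ∪ {l | 1 :: l ∈ ftmLang (n + 1)} := by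
    ext l
    constructor
    · intro h
      obtain ⟨c, hc⟩ := exists_cons_mem_ftmLang h
      obtain rfl | rfl := hz c
      exacts [Or.inl hc, Or.inr hc]
    · rintro (h | h) <;> exact tail_mem_ftmLang h
  have hinter : leftSpecial n =
      {l | 0 :: l ∈ ftmLang (n + 1)} ∩ {l | 1 :: l ∈ ftmLang (n + 1)} := by
    ext l
    refine ⟨fun h => ⟨h 0, h 1⟩, fun h c => ?_⟩
    obtain rfl | rfl := hz c
    exacts [h.1, h.2]
  have hsplit : ftmLang (n + 1) = List.cons 0 '' {l | 0 :: l ∈ ftmLang (n + 1)} ∪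
      List.cons 1 '' {l | 1 :: l ∈ ftmLang (n + 1)} := by
    ext l
    constructor
    · intro h
      obtain ⟨c, m, rfl⟩ : ∃ c m, l = c :: m :=
        List.exists_cons_of_length_eq_add_one (length_of_mem_ftmLang h)
      obtain rfl | rfl := hz c
      exacts [Or.inl ⟨m, h, rfl⟩, Or.inr ⟨m, h, rfl⟩]
    · rintro (⟨m, h, rfl⟩ | ⟨m, h, rfl⟩) <;> exact h
  have hdisj : Disjoint (List.cons 0 '' {l | 0 :: l ∈ ftmLang (n + 1)})
      (List.cons 1 '' {l | (1 : ZMod 2) :: l ∈ ftmLang (n + 1)}) := by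
    rw [Set.disjoint_left]
    rintro _ ⟨m, _, rfl⟩ ⟨m', _, h⟩
    simp at h
  have h1 : (ftmLang (n + 1)).ncard =
      {l | 0 :: l ∈ ftmLang (n + 1)}.ncard + {l | 1 :: l ∈ ftmLang (n + 1)}.ncard := by
    conv_lhs => rw [hsplit]
    rw [Set.ncard_union_eq hdisj ((hA 0).image _) ((hA 1).image _),
      Set.ncard_image_of_injective _ (List.cons_injective),
      Set.ncard_image_of_injective _ (List.cons_injective)]
  have h2 := Set.ncard_union_add_ncard_inter _ _ (hA 0) (hA 1)
  rw [← hunion, ← hinter] at h2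
  rw [ftmDiff, ← ncard_ftmLang, ← ncard_ftmLang]
  omega

lemma card_le_ftmDiff {n : ℕ} {T : Finset (List (ZMod 2))} (h : ∀ l ∈ T, l ∈ leftSpecial n) :
    (T.card : ℤ) ≤ ftmDiff n := by
  rw [ftmDiff_eq_ncard]
  have hfin : (leftSpecial n).Finite :=
    (finite_ftmLang n).subset fun l hl => tail_mem_ftmLang (hl 0)
  have := Set.ncard_le_ncard (s := (T : Set (List (ZMod 2)))) h hfin
  rw [Set.ncard_coe_finset] at this
  exact_mod_cast this

lemma shiftWord_mem_leftSpecial {n : ℕ} {l : List (ZMod 2)} (s : ZMod 2)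
    (h : l ∈ leftSpecial n) : shiftWord s l ∈ leftSpecial n := by
  intro c
  have := shiftWord_mem_ftmLang s (h (c - s))
  simpa using this

/-! ### Fibonacci prefixes -/

/-- The prefix of `ftm` of Fibonacci length `F_k`, see `ftmFactor_zero_fib`. -/
def fibPrefix : ℕ → List (ZMod 2)
  | 0 => []
  | 1 => [0]
  | k + 2 => fibPrefix (k + 1) ++ shiftWord 1 (fibPrefix k)

lemma fibPrefix_add_two (k : ℕ) :
    fibPrefix (k + 2) = fibPrefix (k + 1) ++ shiftWord 1 (fibPrefix k) := rfl

@[simp] lemma length_fibPrefix (k : ℕ) : (fibPrefix k).length = Nat.fib k := by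
  induction k using fibPrefix.induct with
  | case1 => rfl
  | case2 => rfl
  | case3 k h1 h2 => rw [fibPrefix_add_two, Nat.fib_add_two]; simp [h1, h2, add_comm]

lemma ftmFactor_zero_fib (k : ℕ) : ftmFactor 0 (Nat.fib k) = fibPrefix k := by
  induction k using fibPrefix.induct with
  | case1 => rfl
  | case2 => simp [ftmFactor, fibPrefix, ftm]
  | case3 k h1 h2 =>
    rw [fibPrefix_add_two, Nat.fib_add_two, add_comm, ftmFactor_add, h1, zero_add]
    congr 1
    rcases Nat.eq_zero_or_pos k with rfl | hk
    · rfl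
    · rw [← h2]
      simpa using ftmFactor_fib_add (k := k + 1) (i := 0) (n := Nat.fib k) (by omega) (by simp)

lemma mem_ftmLang_of_infix {n k : ℕ} {l : List (ZMod 2)} (hn : l.length = n)
    (h : l <:+: fibPrefix k) : l ∈ ftmLang n := by
  obtain ⟨u, v, h⟩ := h
  rw [← ftmFactor_zero_fib] at h
  have hlen := congrArg List.length h
  simp only [List.length_append, length_ftmFactor] at hlen
  rw [show Nat.fib k = u.length + (n + v.length) by omega, ftmFactor_add, ftmFactor_add,
    List.append_assoc] at h
  have h1 := List.append_inj_right h (by simp)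
  exact ⟨_, (List.append_inj_left h1 (by simp [hn])).symm⟩

lemma card_le_ftmDiff_of_infix {n k m : ℕ} (T : Finset (List (ZMod 2))) (hm : T.card = m)
    (h : ∀ l ∈ T, l.length = n ∧ ∀ c : ZMod 2, c :: l <:+: fibPrefix k) :
    (m : ℤ) ≤ ftmDiff n :=
  hm ▸ card_le_ftmDiff fun l hl c => mem_ftmLang_of_infix (by simp [(h l hl).1]) ((h l hl).2 c)

lemma one_le_ftmDiff_zero : 1 ≤ ftmDiff 0 :=
  card_le_ftmDiff_of_infix (k := 10) {[]} (by decide +kernel)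
    (by decide +kernel)

lemma two_le_ftmDiff_one : 2 ≤ ftmDiff 1 :=
  card_le_ftmDiff_of_infix (k := 10) {[0], [1]} (by decide +kernel)
    (by decide +kernel)

lemma four_le_ftmDiff_two : 4 ≤ ftmDiff 2 :=
  card_le_ftmDiff_of_infix (k := 10) {[0, 0], [0, 1], [1, 0], [1, 1]} (by decide +kernel)
    (by decide +kernel)

lemma ten_le_ftmDiff_four : 10 ≤ ftmDiff 4 :=
  card_le_ftmDiff_of_infix (k := 10)
    {[0, 0, 1, 0], [0, 0, 1, 1], [0, 1, 0, 0], [0, 1, 1, 0], [0, 1, 1, 1],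
      [1, 0, 0, 0], [1, 0, 0, 1], [1, 0, 1, 1], [1, 1, 0, 0], [1, 1, 0, 1]} (by decide +kernel)
    (by decide +kernel)

/-! ### Left extensions of the prefixes -/

lemma two_le_fib {p : ℕ} (hp : 3 ≤ p) : 2 ≤ Nat.fib p :=
  (show Nat.fib 3 = 2 from rfl) ▸ Nat.fib_mono hp

lemma ftmFactor_fib_sub_two {p : ℕ} (hp : 3 ≤ p) :
    ftmFactor (Nat.fib (p + 2) - 2) 2 = shiftWord 1 (ftmFactor (Nat.fib p - 2) 2) := by
  have h3 : 2 ≤ Nat.fib p := two_le_fib hp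
  have e : Nat.fib (p + 2) - 2 = Nat.fib (p + 1) + (Nat.fib p - 2) := by
    rw [Nat.fib_add_two]; omega
  rw [e]
  exact ftmFactor_fib_add (by omega) (by rw [Nat.add_sub_cancel]; omega)

lemma ftmFactor_fib_sub_two_add_four (p m : ℕ) (hp : 3 ≤ p) :
    ftmFactor (Nat.fib (p + 4 * m) - 2) 2 = ftmFactor (Nat.fib p - 2) 2 := by
  induction m with
  | zero => rfl
  | succ m ih =>
    rw [show p + 4 * (m + 1) = p + 4 * m + 2 + 2 by ring, ftmFactor_fib_sub_two (by omega),
      ftmFactor_fib_sub_two (by omega), shiftWord_shiftWord, ih]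
    simp [CharTwo.add_self_eq_zero]

lemma ftmFactor_eq_drop (i n k : ℕ) (h : i + n ≤ Nat.fib k) :
    ftmFactor i n = ((fibPrefix k).drop i).take n := by
  obtain ⟨d, hd⟩ := Nat.exists_eq_add_of_le h
  rw [← ftmFactor_zero_fib, hd, add_assoc, ftmFactor_add, List.drop_left' (by simp), zero_add,
    take_ftmFactor _ (by omega)]

lemma ftmFactor_fib_three : ftmFactor (Nat.fib 3 - 2) 2 = [0, 1] := by
  rw [ftmFactor_eq_drop _ _ 7 (by decide)]; decide

lemma ftmFactor_fib_four : ftmFactor (Nat.fib 4 - 2) 2 = [1, 1] := by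
  rw [ftmFactor_eq_drop _ _ 7 (by decide)]; decide

lemma ftmFactor_fib_five : ftmFactor (Nat.fib 5 - 2) 2 = [1, 0] := by
  rw [ftmFactor_eq_drop _ _ 7 (by decide)]; decide

lemma ftmFactor_fib_six : ftmFactor (Nat.fib 6 - 2) 2 = [0, 0] := by
  rw [ftmFactor_eq_drop _ _ 7 (by decide)]; decide

/-- The two letters before position `F_p` run through all four words of length two as `p` varies
modulo four, so every prefix of `ftm` can be preceded by any word of length two. -/
lemma cons_cons_prefix_mem_ftmLang (c d : ZMod 2) (n : ℕ) :
    c :: d :: ftmFactor 0 n ∈ ftmLang (2 + n) := by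
  obtain ⟨r, hr, hcd⟩ : ∃ r, 3 ≤ r ∧ ftmFactor (Nat.fib r - 2) 2 = [c + 1, d + 1] := by
    have h : ∀ x : ZMod 2, x = 0 ∨ x = 1 := by decide
    obtain rfl | rfl := h c <;> obtain rfl | rfl := h d
    · exact ⟨4, by decide, ftmFactor_fib_four⟩
    · exact ⟨5, by decide, ftmFactor_fib_five⟩
    · exact ⟨3, by decide, ftmFactor_fib_three⟩
    · exact ⟨6, by decide, ftmFactor_fib_six⟩
  set p := r + 4 * (n + 2) with hp
  have hfib : n ≤ Nat.fib (p - 1) := by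
    have := Nat.le_fib_self (n := p - 1) (by omega)
    omega
  have h2 : 2 ≤ Nat.fib p := two_le_fib (by omega)
  have key := shiftWord_mem_ftmLang 1
    (Set.mem_range_self (f := fun i => ftmFactor i (2 + n)) (Nat.fib p - 2))
  rw [ftmFactor_add, hp, ftmFactor_fib_sub_two_add_four r _ hr, hcd, ← hp,
    show Nat.fib p - 2 + 2 = Nat.fib p + 0 by omega,
    ftmFactor_fib_add (by omega) (by simpa using hfib)] at key
  simpa [shiftWord_shiftWord, add_one_add_one_zmod, CharTwo.add_self_eq_zero] using key

/-! ### Words that are left special for a bounded range of lengths -/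

lemma fibPrefix_sq_eq (k : ℕ) :
    fibPrefix (k + 2) ++ shiftWord 1 (fibPrefix (k + 2)) =
      fibPrefix (k + 3) ++ fibPrefix k := by
  rw [fibPrefix_add_two (k + 1)]
  conv_lhs => rw [fibPrefix_add_two k]
  simp [shiftWord_shiftWord, CharTwo.add_self_eq_zero, fibPrefix_add_two]

/-- For `W_k` the prefix of length `F_k`, the word `W_k W̅_k` occurs at position `F_{k+1} + F_{k+3}`,
where it is preceded by the complements of the letters before `F_{k+1}`. -/
lemma sq_mem_ftmLang_of_fib_succ {k : ℕ} (hk : 2 ≤ k) :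
    shiftWord 1 (ftmFactor (Nat.fib (k + 1) - 2) 2) ++
      (fibPrefix k ++ shiftWord 1 (fibPrefix k)) ∈ ftmLang (2 + (Nat.fib k + Nat.fib k)) := by
  have h2 : 2 ≤ Nat.fib (k + 1) := two_le_fib (by omega)
  have e2 := Nat.fib_add_two (n := k)
  have e3 := Nat.fib_add_two (n := k + 1)
  have e4 := Nat.fib_add_two (n := k + 2)
  simp only [Nat.add_assoc, Nat.reduceAdd] at e3 e4
  refine ⟨Nat.fib (k + 3) + (Nat.fib (k + 1) - 2), ?_⟩
  simp only []
  rw [ftmFactor_add, ftmFactor_fib_add (by omega) (by simp; omega)]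
  congr 1
  rw [ftmFactor_add]
  congr 1
  · rw [show Nat.fib (k + 3) + (Nat.fib (k + 1) - 2) + 2 =
      Nat.fib (k + 3) + (Nat.fib (k + 1) + 0) by omega,
      ftmFactor_fib_add (by omega) (by simp; omega),
      ftmFactor_fib_add (by omega) (by simp), shiftWord_shiftWord, ftmFactor_zero_fib]
    simp [CharTwo.add_self_eq_zero]
  · rw [show Nat.fib (k + 3) + (Nat.fib (k + 1) - 2) + 2 + Nat.fib k =
      Nat.fib (k + 4) + 0 by omega, ftmFactor_fib_add (by omega) (by simp; omega),
      ftmFactor_zero_fib]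

/-- For `W_k` the prefix of length `F_k`, the word `W̅_k W_k` occurs at position `F_{k+2}`; the lemma
states this for the complements. -/
lemma sq_mem_ftmLang_of_fib_add_two {k : ℕ} (hk : 2 ≤ k) :
    shiftWord 1 (ftmFactor (Nat.fib (k + 2) - 2) 2) ++
      (fibPrefix k ++ shiftWord 1 (fibPrefix k)) ∈ ftmLang (2 + (Nat.fib k + Nat.fib k)) := by
  obtain ⟨k, rfl⟩ := Nat.exists_eq_add_of_le' hk
  have h2 : 2 ≤ Nat.fib (k + 4) := two_le_fib (by omega)
  have e2 := Nat.fib_add_two (n := k)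
  have e3 := Nat.fib_add_two (n := k + 1)
  have e4 := Nat.fib_add_two (n := k + 2)
  have e5 := Nat.fib_add_two (n := k + 3)
  simp only [Nat.add_assoc, Nat.reduceAdd] at e3 e4 e5
  have key := shiftWord_mem_ftmLang 1 (Set.mem_range_self
    (f := fun i => ftmFactor i (2 + (Nat.fib (k + 2) + Nat.fib (k + 2)))) (Nat.fib (k + 4) - 2))
  convert key using 1
  rw [fibPrefix_sq_eq, ftmFactor_add, shiftWord_append]
  congr 1
  rw [show Nat.fib (k + 2) + Nat.fib (k + 2) = Nat.fib (k + 3) + Nat.fib k by omega,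
    ftmFactor_add, shiftWord_append]
  congr 1
  · rw [show Nat.fib (k + 4) - 2 + 2 = Nat.fib (k + 4) + 0 by omega,
      ftmFactor_fib_add (by omega) (by simp), shiftWord_shiftWord, ftmFactor_zero_fib]
    simp [CharTwo.add_self_eq_zero]
  · rw [show Nat.fib (k + 4) - 2 + 2 + Nat.fib (k + 3) = Nat.fib (k + 5) + 0 by omega,
      ftmFactor_fib_add (by omega) (by simp; omega), shiftWord_shiftWord, ftmFactor_zero_fib]
    simp [CharTwo.add_self_eq_zero]

lemma prefix_mem_leftSpecial {u : List (ZMod 2)} (hu : u.length ≤ 1) (s : ZMod 2) (n : ℕ) :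
    shiftWord s ((u ++ ftmFactor 0 n).take n) ∈ leftSpecial n := by
  refine shiftWord_mem_leftSpecial s fun c => ?_
  match u, hu with
  | [], _ =>
    have h := cons_cons_prefix_mem_ftmLang 0 c n
    rw [show 2 + n = (n + 1) + 1 by ring] at h
    simpa [List.take_of_length_le] using tail_mem_ftmLang h
  | [d], _ =>
    have h := take_mem_ftmLang (n + 1) (cons_cons_prefix_mem_ftmLang c d n) (by omega)
    simpa using h

/-- For `W_k` the prefix of length `F_k`, the word `W_k W̅_k`, lengthened to the left by one letter
if `k` is even, is left special. The two occurrences used are preceded by the letters before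
`F_{k+1}` and before `F_{k+2}`. -/
lemma exists_left_extension_sq {k : ℕ} (hk : 2 ≤ k) :
    ∃ u : List (ZMod 2), u.length = (k + 1) % 2 ∧
      ∀ c, c :: (u ++ (fibPrefix k ++ shiftWord 1 (fibPrefix k))) ∈
        ftmLang (1 + (k + 1) % 2 + (Nat.fib k + Nat.fib k)) := by
  have h1 := sq_mem_ftmLang_of_fib_succ hk
  have h2 := sq_mem_ftmLang_of_fib_add_two hk
  have hz : ∀ c : ZMod 2, c = 0 ∨ c = 1 := by decide
  set V := fibPrefix k ++ shiftWord 1 (fibPrefix k)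
  set N := Nat.fib k + Nat.fib k
  obtain ⟨m, h⟩ : ∃ m, k + 1 = 3 + 4 * m ∨ k + 1 = 4 + 4 * m ∨ k + 1 = 5 + 4 * m ∨
      k + 1 = 6 + 4 * m := ⟨(k - 2) / 4, by omega⟩
  have htail : ∀ {c d : ZMod 2}, c :: d :: V ∈ ftmLang (2 + N) → d :: V ∈ ftmLang (1 + N) := by
    intro c d h
    rw [show 2 + N = (1 + N) + 1 by ring] at h
    exact tail_mem_ftmLang h
  rcases h with h | h | h | h
  · rw [h, ftmFactor_fib_sub_two_add_four 3 m (by omega), ftmFactor_fib_three] at h1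
    rw [show k + 2 = 4 + 4 * m by omega, ftmFactor_fib_sub_two_add_four 4 m (by omega),
      ftmFactor_fib_four] at h2
    rw [show (k + 1) % 2 = 1 by omega]
    refine ⟨[0], rfl, fun c => ?_⟩
    obtain rfl | rfl := hz c
    exacts [h2, h1]
  · rw [h, ftmFactor_fib_sub_two_add_four 4 m (by omega), ftmFactor_fib_four] at h1
    rw [show k + 2 = 5 + 4 * m by omega, ftmFactor_fib_sub_two_add_four 5 m (by omega),
      ftmFactor_fib_five] at h2
    rw [show (k + 1) % 2 = 0 by omega]
    refine ⟨[], rfl, fun c => ?_⟩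
    obtain rfl | rfl := hz c
    exacts [htail h1, htail h2]
  · rw [h, ftmFactor_fib_sub_two_add_four 5 m (by omega), ftmFactor_fib_five] at h1
    rw [show k + 2 = 6 + 4 * m by omega, ftmFactor_fib_sub_two_add_four 6 m (by omega),
      ftmFactor_fib_six] at h2
    rw [show (k + 1) % 2 = 1 by omega]
    refine ⟨[1], rfl, fun c => ?_⟩
    obtain rfl | rfl := hz c
    exacts [h1, h2]
  · rw [h, ftmFactor_fib_sub_two_add_four 6 m (by omega), ftmFactor_fib_six] at h1
    rw [show k + 2 = 3 + 4 * (m + 1) by omega,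
      ftmFactor_fib_sub_two_add_four 3 (m + 1) (by omega), ftmFactor_fib_three] at h2
    rw [show (k + 1) % 2 = 0 by omega]
    refine ⟨[], rfl, fun c => ?_⟩
    obtain rfl | rfl := hz c
    exacts [htail h2, htail h1]

/-- The prefixes of length `n` of `ftm`, `0 ftm`, `1 ftm` and of their complements. -/
def prefixSpecials (n : ℕ) : Finset (List (ZMod 2)) :=
  (({[], [0], [1]} : Finset (List (ZMod 2))) ×ˢ Finset.univ).image
    fun q => shiftWord q.2 ((q.1 ++ ftmFactor 0 n).take n)

lemma ftmFactor_zero_three : ftmFactor 0 3 = [0, 1, 1] := by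
  rw [ftmFactor_eq_drop _ _ 7 (by decide)]; decide

/-- Words that are continued by `ftm`, whose first letters are `[0, 1, 1]`, are told apart by their
first three letters; see `prefixSpecials_injOn`. -/
lemma take_three_eq {n : ℕ} (hn : 3 ≤ n) (u v : List (ZMod 2)) (s : ZMod 2)
    (hv : v.take 3 = [0, 1, 1]) :
    (shiftWord s ((u ++ v).take n)).take 3 = shiftWord s ((u ++ [0, 1, 1]).take 3) := by
  rw [← shiftWord_take, List.take_take, min_eq_left hn, ← hv]
  simp only [List.take_append, List.take_take]
  congr 3
  omega

lemma prefixSpecials_injOn : Set.InjOn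
    (fun q : List (ZMod 2) × ZMod 2 => shiftWord q.2 ((q.1 ++ [0, 1, 1]).take 3))
    ((({[], [0], [1]} : Finset (List (ZMod 2))) ×ˢ Finset.univ :
      Finset (List (ZMod 2) × ZMod 2)) : Set (List (ZMod 2) × ZMod 2)) := by
  have h : ∀ q ∈ ({[], [0], [1]} : Finset (List (ZMod 2))) ×ˢ (Finset.univ : Finset (ZMod 2)),
      ∀ r ∈ ({[], [0], [1]} : Finset (List (ZMod 2))) ×ˢ (Finset.univ : Finset (ZMod 2)),
      shiftWord q.2 ((q.1 ++ [0, 1, 1]).take 3) = shiftWord r.2 ((r.1 ++ [0, 1, 1]).take 3) →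
      q = r := by decide +kernel
  intro q hq r hr
  exact h q hq r hr

lemma take_three_ftmFactor {n : ℕ} (hn : 3 ≤ n) : (ftmFactor 0 n).take 3 = [0, 1, 1] := by
  rw [take_ftmFactor _ hn, ftmFactor_zero_three]

lemma card_prefixSpecials {n : ℕ} (hn : 3 ≤ n) : (prefixSpecials n).card = 6 := by
  rw [prefixSpecials, Finset.card_image_of_injOn]
  · decide
  · intro q hq r hr h
    refine prefixSpecials_injOn hq hr ?_
    have := congrArg (List.take 3) h
    simpa only [take_three_eq hn _ _ _ (take_three_ftmFactor hn)] using this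

lemma mem_leftSpecial_of_mem_prefixSpecials {n : ℕ} {l : List (ZMod 2)}
    (h : l ∈ prefixSpecials n) : l ∈ leftSpecial n := by
  simp only [prefixSpecials, Finset.mem_image, Finset.mem_product] at h
  obtain ⟨q, hq, rfl⟩ := h
  refine prefix_mem_leftSpecial ?_ _ _
  have : ∀ u ∈ ({[], [0], [1]} : Finset (List (ZMod 2))), u.length ≤ 1 := by decide
  exact this _ hq.1

lemma six_le_ftmDiff {n : ℕ} (hn : 3 ≤ n) : 6 ≤ ftmDiff n := by
  have := card_le_ftmDiff (T := prefixSpecials n) fun l hl =>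
    mem_leftSpecial_of_mem_prefixSpecials hl
  rwa [card_prefixSpecials hn] at this

/-- The word `W_k W̅_k`, for `W_k` the prefix of length `F_k`, agrees with `ftm` up to length
`F_{k+1}` but not at position `F_{k+1}`. -/
lemma take_sq_ne {k m : ℕ} (hk : 2 ≤ k) (hm : Nat.fib (k + 3) < m) {n : ℕ} (hn : m ≤ n) :
    (fibPrefix (k + 2) ++ shiftWord 1 (fibPrefix (k + 2))).take m ≠ (ftmFactor 0 n).take m := by
  intro h
  have h1 := congrArg (List.take (Nat.fib (k + 3) + 1)) h
  have e3 := Nat.fib_add_two (n := k + 1)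
  have e4 := Nat.fib_add_two (n := k + 2)
  simp only [Nat.add_assoc, Nat.reduceAdd] at e3 e4
  have hk1 : 1 ≤ Nat.fib k := Nat.fib_pos.2 (by omega)
  have hk2 : 1 ≤ Nat.fib (k + 2) := Nat.fib_pos.2 (by omega)
  rw [List.take_take, List.take_take, min_eq_left (by omega), fibPrefix_sq_eq,
    take_ftmFactor _ (by omega), ftmFactor_add, ftmFactor_zero_fib, List.take_append,
    List.take_of_length_le (by simp)] at h1
  have h2 := List.append_cancel_left h1
  rw [length_fibPrefix, Nat.add_sub_cancel_left, ← ftmFactor_zero_fib, take_ftmFactor _ hk1] at h2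
  have h3 := ftmFactor_fib_add (k := k + 3) (i := 0) (n := 1) (by omega) (by simpa using hk2)
  rw [show 0 + Nat.fib (k + 3) = Nat.fib (k + 3) + 0 by omega, h3] at h2
  simp [ftmFactor, shiftWord] at h2

lemma eight_le_ftmDiff {k n : ℕ} (hk : 4 ≤ k) (h1 : Nat.fib (k + 1) + (k + 1) % 2 < n)
    (h2 : n ≤ 2 * Nat.fib k + (k + 1) % 2) : 8 ≤ ftmDiff n := by
  obtain ⟨u, hu, hV⟩ := exists_left_extension_sq (k := k) (by omega)
  have hfib : 3 ≤ Nat.fib k := (show Nat.fib 4 = 3 from rfl) ▸ Nat.fib_mono hk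
  have hmono : Nat.fib k ≤ Nat.fib (k + 1) := Nat.fib_le_fib_succ
  have hz : ∀ c : ZMod 2, c = 0 ∨ c = 1 := by decide
  set V := fibPrefix k ++ shiftWord 1 (fibPrefix k) with hVdef
  have hn : 3 ≤ n := by omega
  have humem : u ∈ ({[], [0], [1]} : Finset (List (ZMod 2))) := by
    match u, (show u.length ≤ 1 by omega) with
    | [], _ => simp
    | [c], _ => obtain rfl | rfl := hz c <;> decide
  have hV3 : V.take 3 = [0, 1, 1] := by
    rw [hVdef, List.take_append_of_le_length (by simpa using hfib), ← ftmFactor_zero_fib,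
      take_three_ftmFactor hfib]
  have hspec : ∀ s, shiftWord s ((u ++ V).take n) ∈ leftSpecial n := fun s =>
    shiftWord_mem_leftSpecial s fun c => by
      simpa using take_mem_ftmLang (n + 1) (hV c) (by omega)
  -- The new words are told apart from the prefixes by their first three letters, or else by the
  -- letter at position `F_{k+1}` of `V`.
  have hnew : ∀ s, shiftWord s ((u ++ V).take n) ∉ prefixSpecials n := by
    intro s hs
    simp only [prefixSpecials, Finset.mem_image] at hs
    obtain ⟨q, hq, h⟩ := hs
    have h3 := congrArg (List.take 3) h
    rw [take_three_eq hn _ _ _ (take_three_ftmFactor hn), take_three_eq hn _ _ _ hV3] at h3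
    have hqs : q = (u, s) := prefixSpecials_injOn hq (by simpa using humem) h3
    subst hqs
    have h4 := shiftWord_injective _ h
    simp only [List.take_append, hu] at h4
    have h5 := List.append_cancel_left h4
    obtain ⟨k, rfl⟩ := Nat.exists_eq_add_of_le' (show 2 ≤ k by omega)
    have e : k + 2 + 1 = k + 3 := rfl
    rw [e] at h1
    exact take_sq_ne (k := k) (by omega) (by omega) (Nat.sub_le n _) h5.symm
  have hinj : Function.Injective fun s => shiftWord s ((u ++ V).take n) := by
    intro s t h
    have h3 := congrArg (List.take 3) h
    simp only [take_three_eq hn _ _ _ hV3] at h3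
    exact congrArg Prod.snd
      (prefixSpecials_injOn (x₁ := (u, s)) (x₂ := (u, t)) (by simpa using humem)
        (by simpa using humem) h3)
  have hdisj : Disjoint (prefixSpecials n)
      (Finset.univ.image fun s => shiftWord s ((u ++ V).take n)) := by
    rw [Finset.disjoint_right]
    intro l hl
    obtain ⟨s, -, rfl⟩ := Finset.mem_image.1 hl
    exact hnew s
  have := card_le_ftmDiff (n := n)
    (T := prefixSpecials n ∪ Finset.univ.image fun s => shiftWord s ((u ++ V).take n)) fun l hl => by
      rcases Finset.mem_union.1 hl with hl | hl
      · exact mem_leftSpecial_of_mem_prefixSpecials hl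
      · obtain ⟨s, -, rfl⟩ := Finset.mem_image.1 hl
        exact hspec s
  rw [Finset.card_union_of_disjoint hdisj, card_prefixSpecials hn,
    Finset.card_image_of_injective _ hinj] at this
  simpa using this

/-! ### Windows in concatenations of Fibonacci blocks -/

/-- The block of length `n` of the list `U` at offset `t`. -/
def listWindow (n : ℕ) (U : List (ZMod 2)) (t : ℕ) : List (ZMod 2) := (U.drop t).take n

lemma listWindow_append_left {n t : ℕ} {U V : List (ZMod 2)} (h : t + n ≤ U.length) :
    listWindow n (U ++ V) t = listWindow n U t := by
  rw [listWindow, List.drop_append_of_le_length (by omega),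
    List.take_append_of_le_length (by simp; omega), listWindow]

lemma listWindow_append_right (n t : ℕ) (U V : List (ZMod 2)) :
    listWindow n (U ++ V) (U.length + t) = listWindow n V t := by
  rw [listWindow, ← List.drop_drop, List.drop_left, listWindow]

lemma listWindow_zero {n : ℕ} {U V : List (ZMod 2)} (h : U.length = n) :
    listWindow n (U ++ V) 0 = U := by
  simp [listWindow, List.take_left' h]

lemma listWindow_pred {n t : ℕ} {U V : List (ZMod 2)} (ht : t + 1 = U.length) :
    ∃ c, listWindow n (U ++ V) t = (c :: V).take n := by
  have hU : U ≠ [] := by rintro rfl; simp at ht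
  refine ⟨U.getLast hU, ?_⟩
  conv_lhs => rw [← List.dropLast_append_getLast hU, List.append_assoc]
  have hlen : t = U.dropLast.length + 0 := by simp; omega
  rw [hlen, listWindow_append_right]
  simp [listWindow]

lemma zmod_two_eq_or (p q : ZMod 2) : q = p ∨ q = p + 1 := by revert p q; decide

lemma shiftWord_fibPrefix_add_two (p : ZMod 2) (k : ℕ) :
    shiftWord p (fibPrefix (k + 2)) =
      shiftWord p (fibPrefix (k + 1)) ++ shiftWord (p + 1) (fibPrefix k) := by
  simp [fibPrefix_add_two, shiftWord_shiftWord, add_comm]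

/-- The blocks into which `ftm` is cut: a pair `(b, p)` stands for the prefix of length `F_k`
(if `b` is true) or `F_{k+1}` (if `b` is false), complemented if `p = 1`. -/
def fibBlock (k : ℕ) (x : Bool × ZMod 2) : List (ZMod 2) :=
  shiftWord x.2 (fibPrefix (if x.1 then k else k + 1))

/-- The morphism by which a block of one level is cut into blocks of the previous level. -/
def fibMorphism : Bool × ZMod 2 → List (Bool × ZMod 2)
  | (false, p) => [(false, p), (true, p + 1)]
  | (true, p) => [(false, p)]

/-- A short block can only follow the long block of opposite sign. -/
def fibAdj (x y : Bool × ZMod 2) : Prop := y.1 = true → x = (false, y.2 + 1)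

lemma flatMap_fibMorphism (k : ℕ) (x : Bool × ZMod 2) :
    (fibMorphism x).flatMap (fibBlock k) = fibBlock (k + 1) x := by
  obtain ⟨b, p⟩ := x
  cases b
  · simp [fibMorphism, fibBlock, shiftWord_fibPrefix_add_two]
  · simp [fibMorphism, fibBlock]

lemma isChain_flatMap_fibMorphism (L : List (Bool × ZMod 2)) :
    (L.flatMap fibMorphism).IsChain fibAdj := by
  induction L with
  | nil => simp
  | cons x L ih =>
    rw [List.flatMap_cons, List.isChain_append]
    refine ⟨?_, ih, ?_⟩
    · obtain ⟨b, p⟩ := x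
      cases b
      · simp [fibMorphism, fibAdj, add_one_add_one_zmod]
      · simp [fibMorphism]
    · intro a _ y hy
      cases L with
      | nil => simp at hy
      | cons z L =>
        obtain ⟨b, q⟩ := z
        cases b <;> simp [fibMorphism] at hy <;> simp [← hy, fibAdj]

/-- Every long Fibonacci prefix is a concatenation of blocks of level `k`. -/
lemma exists_flatMap_fibBlock (k m : ℕ) :
    ∃ L : List (Bool × ZMod 2), L.IsChain fibAdj ∧ L.flatMap (fibBlock k) = fibPrefix (k + m + 1) := by
  have h : ∀ m k, ∃ L : List (Bool × ZMod 2), L.flatMap (fibBlock k) = fibPrefix (k + m + 1) := by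
    intro m
    induction m with
    | zero => exact fun k => ⟨[(false, 0)], by simp [fibBlock]⟩
    | succ m ih =>
      intro k
      obtain ⟨L, hL⟩ := ih (k + 1)
      refine ⟨L.flatMap fibMorphism, ?_⟩
      rw [List.flatMap_assoc]
      simp only [flatMap_fibMorphism, hL]
      congr 1
      ring
  cases m with
  | zero => exact ⟨[(false, 0)], by simp, by simp [fibBlock]⟩
  | succ m =>
    obtain ⟨L, hL⟩ := h m (k + 1)
    refine ⟨L.flatMap fibMorphism, isChain_flatMap_fibMorphism L, ?_⟩
    rw [List.flatMap_assoc]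
    simp only [flatMap_fibMorphism, hL]
    congr 1
    ring

/-- The property of being, up to complement, a window of length `F_{k+2}` in one of four short
concatenations of the prefixes of length `F_{k+2}` and `F_{k+1}`. -/
def IsPairWindow (k : ℕ) (w : List (ZMod 2)) : Prop :=
  ∃ p t, (t < Nat.fib (k + 2) ∧ w = listWindow (Nat.fib (k + 2))
      (shiftWord p (fibPrefix (k + 2)) ++ shiftWord p (fibPrefix (k + 2))) t) ∨
    (t < Nat.fib (k + 2) ∧ w = listWindow (Nat.fib (k + 2))
      (shiftWord p (fibPrefix (k + 2)) ++ shiftWord (p + 1) (fibPrefix (k + 2))) t) ∨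
    (t < Nat.fib (k + 3) ∧ w = listWindow (Nat.fib (k + 2))
      ((shiftWord p (fibPrefix (k + 2)) ++ shiftWord (p + 1) (fibPrefix (k + 1))) ++
        shiftWord (p + 1) (fibPrefix (k + 2))) t) ∨
    (t < Nat.fib (k + 1) ∧ w = listWindow (Nat.fib (k + 2))
      (shiftWord (p + 1) (fibPrefix (k + 1)) ++ shiftWord p (fibPrefix (k + 2))) t)

lemma exists_fibPrefix_eq_append {j k : ℕ} (h : j ≤ k) : ∃ R, fibPrefix k = fibPrefix j ++ R := by
  obtain ⟨d, hd⟩ := Nat.exists_eq_add_of_le (Nat.fib_mono h)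
  exact ⟨ftmFactor (Nat.fib j) d, by
    rw [← ftmFactor_zero_fib, hd, ftmFactor_add, ftmFactor_zero_fib, zero_add]⟩

lemma isPairWindow_of_isChain (k : ℕ) (L : List (Bool × ZMod 2)) (hL : L.IsChain fibAdj) (t : ℕ)
    (ht : t + Nat.fib (k + 2) ≤ (L.flatMap (fibBlock (k + 1))).length) :
    IsPairWindow k (listWindow (Nat.fib (k + 2)) (L.flatMap (fibBlock (k + 1))) t) := by
  have hpos : 0 < Nat.fib (k + 1) := Nat.fib_pos.2 (by omega)
  have e2 : Nat.fib (k + 2) = Nat.fib k + Nat.fib (k + 1) := Nat.fib_add_two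
  have e3 : Nat.fib (k + 3) = Nat.fib (k + 1) + Nat.fib (k + 2) := Nat.fib_add_two
  induction L generalizing t with
  | nil =>
    simp only [List.flatMap_nil, List.length_nil] at ht
    omega
  | cons x L ih =>
    rw [List.flatMap_cons] at ht ⊢
    by_cases hx : (fibBlock (k + 1) x).length ≤ t
    · obtain ⟨d, rfl⟩ := Nat.exists_eq_add_of_le hx
      rw [listWindow_append_right]
      refine ih hL.tail d ?_
      rw [List.length_append] at ht
      omega
    · obtain ⟨b, p⟩ := x
      cases b
      · simp only [fibBlock, Bool.false_eq_true, if_false, length_shiftWord, length_fibPrefix,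
          List.length_append, Nat.add_assoc, Nat.reduceAdd] at hx ht ⊢
        match L, hL with
        | [], _ =>
          simp only [List.flatMap_nil, List.length_nil] at ht
          obtain rfl : t = 0 := by omega
          refine ⟨p, 0, Or.inl ⟨by omega, ?_⟩⟩
          rw [listWindow_zero (by simp), listWindow_zero (by simp)]
        | (false, q) :: L, _ =>
          refine ⟨p, t, ?_⟩
          obtain rfl | rfl := zmod_two_eq_or p q
          · refine Or.inl ⟨by omega, ?_⟩
            rw [List.flatMap_cons, ← List.append_assoc, listWindow_append_left]
            · simp [fibBlock]
            · simp [fibBlock]; omega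
          · refine Or.inr (Or.inl ⟨by omega, ?_⟩)
            rw [List.flatMap_cons, ← List.append_assoc, listWindow_append_left]
            · simp [fibBlock]
            · simp [fibBlock]; omega
        | [(true, q)], hL =>
          have hadj : fibAdj (false, p) (true, q) := by simpa using hL
          have hq := hadj rfl
          simp only [Prod.mk.injEq, true_and] at hq
          subst hq
          refine ⟨q + 1, t, Or.inr (Or.inr (Or.inl ⟨by omega, ?_⟩))⟩
          simp only [List.flatMap_cons, List.flatMap_nil, fibBlock, if_true, List.append_nil,
            length_shiftWord, length_fibPrefix] at ht ⊢
          rw [add_one_add_one_zmod]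
          refine (listWindow_append_left ?_).symm
          simpa using ht
        | (true, q) :: (false, r) :: L, hL =>
          have hadj : fibAdj (false, p) (true, q) := (List.isChain_cons_cons.1 hL).1
          have hq := hadj rfl
          simp only [Prod.mk.injEq, true_and] at hq
          subst hq
          refine ⟨q + 1, t, ?_⟩
          simp only [List.flatMap_cons, fibBlock, if_true, Bool.false_eq_true, if_false,
            Nat.add_assoc, Nat.reduceAdd, add_one_add_one_zmod]
          obtain rfl | rfl := zmod_two_eq_or q r
          · refine Or.inr (Or.inr (Or.inl ⟨by omega, ?_⟩))
            rw [← List.append_assoc, ← List.append_assoc, listWindow_append_left]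
            simp only [List.length_append, length_shiftWord, length_fibPrefix]
            omega
          · refine Or.inr (Or.inl ⟨by omega, ?_⟩)
            obtain ⟨R, hR⟩ := exists_fibPrefix_eq_append (show k ≤ k + 2 by omega)
            have hlen : t + Nat.fib (k + 2) ≤ (shiftWord (q + 1) (fibPrefix (k + 2)) ++
                (shiftWord q (fibPrefix (k + 1)) ++ shiftWord (q + 1) (fibPrefix k))).length := by
              simp only [List.length_append, length_shiftWord, length_fibPrefix]
              omega
            have hw : shiftWord (q + 1) (fibPrefix (k + 2)) ++ (shiftWord q (fibPrefix (k + 1)) ++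
                (shiftWord (q + 1) (fibPrefix (k + 2)) ++ L.flatMap (fibBlock (k + 1)))) =
                (shiftWord (q + 1) (fibPrefix (k + 2)) ++ (shiftWord q (fibPrefix (k + 1)) ++
                shiftWord (q + 1) (fibPrefix k))) ++
                (shiftWord (q + 1) R ++ L.flatMap (fibBlock (k + 1))) := by
              conv_lhs => arg 2; arg 2; rw [hR]
              simp only [shiftWord_append, List.append_assoc]
            rw [hw, listWindow_append_left hlen, shiftWord_fibPrefix_add_two q k]
        | (true, q) :: (true, r) :: L, hL =>
          have hadj : fibAdj (true, q) (true, r) :=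
            (List.isChain_cons_cons.1 (List.isChain_cons_cons.1 hL).2).1
          simpa using hadj rfl
      · simp only [fibBlock, if_true, length_shiftWord, length_fibPrefix,
          List.length_append] at hx ht ⊢
        match L, hL with
        | [], _ =>
          have h0 : Nat.fib k = 0 ∧ t = 0 := by simp at ht; omega
          have hk : k = 0 := Nat.fib_eq_zero.1 h0.1
          obtain ⟨hk0, rfl⟩ := h0
          subst hk
          refine ⟨p, 0, Or.inl ⟨by omega, ?_⟩⟩
          rw [listWindow_zero (by simp), listWindow_zero (by simp)]
          simp [fibPrefix]
        | (false, r) :: L, _ =>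
          simp only [List.flatMap_cons, fibBlock, Bool.false_eq_true, if_false]
          obtain rfl | rfl := zmod_two_eq_or p r
          · refine ⟨r + 1, Nat.fib (k + 2) + t, Or.inr (Or.inr (Or.inl ⟨by omega, ?_⟩))⟩
            have hl := listWindow_append_right (Nat.fib (k + 2)) t
              (shiftWord (r + 1) (fibPrefix (k + 2)))
              (shiftWord r (fibPrefix (k + 1)) ++ shiftWord r (fibPrefix (k + 2)))
            rw [length_shiftWord, length_fibPrefix] at hl
            rw [add_one_add_one_zmod, List.append_assoc (shiftWord (r + 1) _), hl,
              ← List.append_assoc, listWindow_append_left (by simp; omega)]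
          · refine ⟨p + 1, t, Or.inr (Or.inr (Or.inr ⟨by omega, ?_⟩))⟩
            rw [← List.append_assoc, listWindow_append_left (by simp; omega),
              add_one_add_one_zmod]
        | (true, r) :: L, hL =>
          have hadj : fibAdj (true, p) (true, r) := (List.isChain_cons_cons.1 hL).1
          simpa using hadj rfl

lemma isPairWindow_ftmFactor (k i : ℕ) : IsPairWindow k (ftmFactor i (Nat.fib (k + 2))) := by
  obtain ⟨q, hq, hn⟩ := exists_le_fib (i + Nat.fib (k + 2))
  obtain ⟨L, hL, h⟩ := exists_flatMap_fibBlock (k + 1) q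
  have hle : i + Nat.fib (k + 2) ≤ Nat.fib (k + 1 + q + 1) :=
    hn.trans (Nat.fib_mono (by omega))
  have := isPairWindow_of_isChain k L hL i (by rw [h, length_fibPrefix]; exact hle)
  rwa [h, listWindow, ← ftmFactor_eq_drop _ _ _ hle] at this

/-! ### The upper bound at Fibonacci lengths -/

/-- Representatives of all factors of length `F_{k+5}`, after removing the coincidences between the
windows of `IsPairWindow`. -/
def fibFactorReps (k : ℕ) : Finset (List (ZMod 2)) :=
  Finset.univ.image (fun p => shiftWord p (fibPrefix (k + 5))) ∪
  (Finset.univ.image (fun q : ZMod 2 × ZMod 2 =>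
    (q.1 :: shiftWord q.2 (fibPrefix (k + 5))).take (Nat.fib (k + 5))) ∪
  ((Finset.univ ×ˢ Finset.Ico 1 (Nat.fib (k + 5) - 1)).image (fun q : ZMod 2 × ℕ =>
    listWindow (Nat.fib (k + 5))
      (shiftWord q.1 (fibPrefix (k + 5)) ++ shiftWord q.1 (fibPrefix (k + 5))) q.2) ∪
  ((Finset.univ ×ˢ Finset.Ico 1 (Nat.fib (k + 5) - 1)).image (fun q : ZMod 2 × ℕ =>
    listWindow (Nat.fib (k + 5))
      (shiftWord q.1 (fibPrefix (k + 5)) ++ shiftWord (q.1 + 1) (fibPrefix (k + 5))) q.2) ∪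
  ((Finset.univ ×ˢ Finset.Ico (Nat.fib (k + 4) + 1) (Nat.fib (k + 6) - 1)).image
    (fun q : ZMod 2 × ℕ => listWindow (Nat.fib (k + 5))
      ((shiftWord q.1 (fibPrefix (k + 5)) ++ shiftWord (q.1 + 1) (fibPrefix (k + 4))) ++
        shiftWord (q.1 + 1) (fibPrefix (k + 5))) q.2) ∪
  (Finset.univ ×ˢ Finset.Ico (Nat.fib (k + 2) + 1) (Nat.fib (k + 4) - 1)).image
    (fun q : ZMod 2 × ℕ => listWindow (Nat.fib (k + 5))
      (shiftWord (q.1 + 1) (fibPrefix (k + 4)) ++ shiftWord q.1 (fibPrefix (k + 5))) q.2)))))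

lemma card_fibFactorReps_le (k : ℕ) :
    (fibFactorReps k).card + 10 ≤ 6 * Nat.fib (k + 5) + 2 * Nat.fib (k + 3) := by
  have h3 : 2 ≤ Nat.fib (k + 3) := two_le_fib (by omega)
  have e4 : Nat.fib (k + 4) = Nat.fib (k + 2) + Nat.fib (k + 3) := Nat.fib_add_two
  have e5 : Nat.fib (k + 5) = Nat.fib (k + 3) + Nat.fib (k + 4) := Nat.fib_add_two
  have e6 : Nat.fib (k + 6) = Nat.fib (k + 4) + Nat.fib (k + 5) := Nat.fib_add_two
  have hcard : ∀ (f : ZMod 2 × ℕ → List (ZMod 2)) (a b : ℕ),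
      ((Finset.univ ×ˢ Finset.Ico a b).image f).card ≤ 2 * (b - a) := fun f a b =>
    Finset.card_image_le.trans (by simp)
  unfold fibFactorReps
  refine (Nat.add_le_add_right ((Finset.card_union_le _ _).trans (Nat.add_le_add
    Finset.card_image_le ((Finset.card_union_le _ _).trans (Nat.add_le_add
    Finset.card_image_le ((Finset.card_union_le _ _).trans (Nat.add_le_add
    (hcard _ _ _) ((Finset.card_union_le _ _).trans (Nat.add_le_add
    (hcard _ _ _) ((Finset.card_union_le _ _).trans (Nat.add_le_add
    (hcard _ _ _) (hcard _ _ _))))))))))) _).trans ?_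
  simp only [Finset.card_univ, Fintype.card_prod, ZMod.card]
  omega

lemma mem_fibFactorReps {k : ℕ} {w : List (ZMod 2)} (h : IsPairWindow (k + 3) w) :
    w ∈ fibFactorReps k := by
  have h3 : 2 ≤ Nat.fib (k + 3) := two_le_fib (by omega)
  have e4 : Nat.fib (k + 4) = Nat.fib (k + 2) + Nat.fib (k + 3) := Nat.fib_add_two
  have e5 : Nat.fib (k + 5) = Nat.fib (k + 3) + Nat.fib (k + 4) := Nat.fib_add_two
  have e6 : Nat.fib (k + 6) = Nat.fib (k + 4) + Nat.fib (k + 5) := Nat.fib_add_two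
  have whole : ∀ p, shiftWord p (fibPrefix (k + 5)) ∈ fibFactorReps k := fun p =>
    Finset.mem_union_left _ (Finset.mem_image_of_mem _ (Finset.mem_univ p))
  have last : ∀ (U : List (ZMod 2)) (p : ZMod 2) (t : ℕ), t + 1 = U.length →
      listWindow (Nat.fib (k + 5)) (U ++ shiftWord p (fibPrefix (k + 5))) t ∈
        fibFactorReps k := by
    intro U p t ht
    obtain ⟨c, hc⟩ := listWindow_pred (n := Nat.fib (k + 5))
      (V := shiftWord p (fibPrefix (k + 5))) ht
    rw [hc]
    exact Finset.mem_union_right _ (Finset.mem_union_left _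
      (Finset.mem_image.2 ⟨(c, p), Finset.mem_univ _, rfl⟩))
  have same : ∀ p t, t < Nat.fib (k + 5) → listWindow (Nat.fib (k + 5))
      (shiftWord p (fibPrefix (k + 5)) ++ shiftWord p (fibPrefix (k + 5))) t ∈
        fibFactorReps k := by
    intro p t ht
    rcases Nat.eq_zero_or_pos t with rfl | h0
    · rw [listWindow_zero (by simp)]
      exact whole p
    by_cases h1 : t + 1 = Nat.fib (k + 5)
    · exact last _ p t (by simpa using h1)
    exact Finset.mem_union_right _ (Finset.mem_union_right _ (Finset.mem_union_left _
      (Finset.mem_image.2 ⟨(p, t), by simp; omega, rfl⟩)))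
  have opposite : ∀ p t, t < Nat.fib (k + 5) → listWindow (Nat.fib (k + 5))
      (shiftWord p (fibPrefix (k + 5)) ++ shiftWord (p + 1) (fibPrefix (k + 5))) t ∈
        fibFactorReps k := by
    intro p t ht
    rcases Nat.eq_zero_or_pos t with rfl | h0
    · rw [listWindow_zero (by simp)]
      exact whole p
    by_cases h1 : t + 1 = Nat.fib (k + 5)
    · exact last _ (p + 1) t (by simpa using h1)
    exact Finset.mem_union_right _ (Finset.mem_union_right _ (Finset.mem_union_right _
      (Finset.mem_union_left _ (Finset.mem_image.2 ⟨(p, t), by simp; omega, rfl⟩))))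
  obtain ⟨p, t, ⟨ht, rfl⟩ | ⟨ht, rfl⟩ | ⟨ht, rfl⟩ | ⟨ht, rfl⟩⟩ := h
  · exact same p t ht
  · exact opposite p t ht
  · simp only [Nat.add_assoc, Nat.reduceAdd] at ht ⊢
    by_cases h1 : t + 1 = Nat.fib (k + 6)
    · exact last _ (p + 1) t (by simp; omega)
    by_cases h2 : t ≤ Nat.fib (k + 4)
    · -- Both words begin with the prefix of length `F_{k+6}`, so these windows coincide.
      have := opposite p t (by omega)
      rw [shiftWord_fibPrefix_add_two (p + 1) (k + 3), ← List.append_assoc,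
        listWindow_append_left (by
          simp only [List.length_append, length_shiftWord, length_fibPrefix, Nat.add_assoc,
            Nat.reduceAdd]
          omega)] at this
      rwa [listWindow_append_left (by simp; omega)]
    exact Finset.mem_union_right _ (Finset.mem_union_right _ (Finset.mem_union_right _
      (Finset.mem_union_right _ (Finset.mem_union_left _
        (Finset.mem_image.2 ⟨(p, t), by simp; omega, rfl⟩)))))
  · simp only [Nat.add_assoc, Nat.reduceAdd] at ht ⊢
    by_cases h1 : t + 1 = Nat.fib (k + 4)
    · exact last _ p t (by simpa using h1)
    by_cases h2 : t ≤ Nat.fib (k + 2)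
    · -- Up to length `F_{k+5} + F_{k+2}` the word agrees with the square of the complement of the
      -- second factor.
      have := same (p + 1) t (by omega)
      have hsplit := fun p => shiftWord_fibPrefix_add_two p (k + 3)
      simp only [Nat.add_assoc, Nat.reduceAdd] at hsplit
      obtain ⟨R, hR⟩ : ∃ R, shiftWord p (fibPrefix (k + 5)) =
          (shiftWord p (fibPrefix (k + 3)) ++ shiftWord (p + 1) (fibPrefix (k + 2))) ++ R :=
        ⟨_, by rw [hsplit, shiftWord_fibPrefix_add_two p (k + 2)]⟩
      obtain ⟨R', hR'⟩ : ∃ R', shiftWord (p + 1) (fibPrefix (k + 5)) =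
          shiftWord (p + 1) (fibPrefix (k + 2)) ++ R' :=
        ⟨_, by
          rw [hsplit, shiftWord_fibPrefix_add_two _ (k + 2), shiftWord_fibPrefix_add_two _ (k + 1),
            List.append_assoc, List.append_assoc]⟩
      have hsq : shiftWord (p + 1) (fibPrefix (k + 5)) ++ shiftWord (p + 1) (fibPrefix (k + 5)) =
          (shiftWord (p + 1) (fibPrefix (k + 4)) ++
            (shiftWord p (fibPrefix (k + 3)) ++ shiftWord (p + 1) (fibPrefix (k + 2)))) ++ R' := by
        conv_lhs => arg 2; rw [hR']
        rw [hsplit (p + 1), add_one_add_one_zmod]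
        simp only [List.append_assoc]
      rw [hsq, listWindow_append_left (by simp; omega)] at this
      rwa [hR, ← List.append_assoc, listWindow_append_left (by simp; omega)]
    exact Finset.mem_union_right _ (Finset.mem_union_right _ (Finset.mem_union_right _
      (Finset.mem_union_right _ (Finset.mem_union_right _
        (Finset.mem_image.2 ⟨(p, t), by simp; omega, rfl⟩)))))

lemma subwordComplexity_ftm_fib_le (k : ℕ) :
    subwordComplexity ftm (Nat.fib (k + 5)) + 10 ≤
      6 * Nat.fib (k + 5) + 2 * Nat.fib (k + 3) := by
  refine le_trans (Nat.add_le_add_right ?_ 10) (card_fibFactorReps_le k)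
  rw [← ncard_ftmLang, ← Set.ncard_coe_finset]
  refine Set.ncard_le_ncard ?_ (Finset.finite_toSet _)
  rintro _ ⟨i, rfl⟩
  exact mem_fibFactorReps (isPairWindow_ftmFactor (k + 3) i)

/-! ### Comparison of the bounds -/

/-- The value of `ftmDiff n` for `F_{k+5} ≤ n < F_{k+6}`. -/
def ftmDiffValue (k n : ℕ) : ℤ :=
  if Nat.fib (k + 5) + (k + 5) % 2 < n ∧ n ≤ 2 * Nat.fib (k + 4) + (k + 5) % 2 then 8 else 6

lemma ftmDiffValue_le {k n : ℕ} (hn : Nat.fib (k + 5) ≤ n) : ftmDiffValue k n ≤ ftmDiff n := by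
  unfold ftmDiffValue
  split_ifs with h
  · exact eight_le_ftmDiff (k := k + 4) (by omega) h.1 h.2
  · have : 2 ≤ Nat.fib (k + 4) := two_le_fib (by omega)
    have : 2 ≤ Nat.fib (k + 3) := two_le_fib (by omega)
    have : Nat.fib (k + 5) = Nat.fib (k + 3) + Nat.fib (k + 4) := Nat.fib_add_two
    exact six_le_ftmDiff (by omega)

lemma sum_ftmDiffValue (k : ℕ) :
    ∑ n ∈ Finset.Ico (Nat.fib (k + 5)) (Nat.fib (k + 6)), ftmDiffValue k n =
      6 * Nat.fib (k + 4) + 2 * Nat.fib (k + 2) := by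
  have h3 : 2 ≤ Nat.fib (k + 3) := two_le_fib (by omega)
  have e4 : Nat.fib (k + 4) = Nat.fib (k + 2) + Nat.fib (k + 3) := Nat.fib_add_two
  have e5 : Nat.fib (k + 5) = Nat.fib (k + 3) + Nat.fib (k + 4) := Nat.fib_add_two
  have e6 : Nat.fib (k + 6) = Nat.fib (k + 4) + Nat.fib (k + 5) := Nat.fib_add_two
  have hval : ∀ n, ftmDiffValue k n = 6 +
      if Nat.fib (k + 5) + (k + 5) % 2 < n ∧ n ≤ 2 * Nat.fib (k + 4) + (k + 5) % 2
      then 2 else 0 := by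
    intro n
    unfold ftmDiffValue
    split_ifs <;> rfl
  have hfilter : {n ∈ Finset.Ico (Nat.fib (k + 5)) (Nat.fib (k + 6)) |
      Nat.fib (k + 5) + (k + 5) % 2 < n ∧ n ≤ 2 * Nat.fib (k + 4) + (k + 5) % 2} =
      Finset.Ioc (Nat.fib (k + 5) + (k + 5) % 2) (2 * Nat.fib (k + 4) + (k + 5) % 2) := by
    ext n
    simp only [Finset.mem_filter, Finset.mem_Ico, Finset.mem_Ioc]
    omega
  simp only [hval]
  rw [Finset.sum_add_distrib, ← Finset.sum_filter, hfilter, Finset.sum_const, Finset.sum_const,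
    Nat.card_Ico, Nat.card_Ioc,
    show Nat.fib (k + 6) - Nat.fib (k + 5) = Nat.fib (k + 4) by omega,
    show 2 * Nat.fib (k + 4) + (k + 5) % 2 - (Nat.fib (k + 5) + (k + 5) % 2) =
      Nat.fib (k + 2) by omega]
  simp [mul_comm]

lemma sum_ftmDiff {a b : ℕ} (h : a ≤ b) : ∑ n ∈ Finset.Ico a b, ftmDiff n =
    (subwordComplexity ftm b : ℤ) - subwordComplexity ftm a :=
  Finset.sum_Ico_sub (fun n => (subwordComplexity ftm n : ℤ)) h

lemma subwordComplexity_ftm_five : (subwordComplexity ftm 5 : ℤ) =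
    1 + ftmDiff 0 + ftmDiff 1 + ftmDiff 2 + ftmDiff 3 + ftmDiff 4 := by
  have h0 : subwordComplexity ftm 0 = 1 := by
    rw [← ncard_ftmLang, Set.ncard_eq_one]
    exact ⟨[], by ext l; simp [ftmLang, ftmFactor]⟩
  simp only [ftmDiff, h0]
  push_cast
  ring

lemma le_subwordComplexity_ftm_fib_succ (k : ℕ) :
    (subwordComplexity ftm (Nat.fib (k + 5)) : ℤ) + (6 * Nat.fib (k + 4) + 2 * Nat.fib (k + 2)) ≤
      subwordComplexity ftm (Nat.fib (k + 6)) := by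
  have h := Finset.sum_le_sum fun n (hn : n ∈ Finset.Ico (Nat.fib (k + 5)) (Nat.fib (k + 6))) =>
    ftmDiffValue_le (Finset.mem_Ico.1 hn).1
  rw [sum_ftmDiffValue, sum_ftmDiff (Nat.fib_mono (by omega))] at h
  linarith

lemma subwordComplexity_ftm_fib (k : ℕ) : (subwordComplexity ftm (Nat.fib (k + 5)) : ℤ) + 10 =
    6 * Nat.fib (k + 5) + 2 * Nat.fib (k + 3) := by
  refine le_antisymm (by exact_mod_cast subwordComplexity_ftm_fib_le k) ?_
  induction k with
  | zero =>
    have h5 := subwordComplexity_ftm_five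
    have h0 := one_le_ftmDiff_zero
    have h1 := two_le_ftmDiff_one
    have h2 := four_le_ftmDiff_two
    have h3 := six_le_ftmDiff (n := 3) le_rfl
    have h4 := ten_le_ftmDiff_four
    have e5 : Nat.fib (0 + 5) = 5 := rfl
    have e3 : Nat.fib (0 + 3) = 2 := rfl
    rw [e5, e3]
    push_cast
    linarith
  | succ k ih =>
    have h := le_subwordComplexity_ftm_fib_succ k
    have e4 : Nat.fib (k + 4) = Nat.fib (k + 2) + Nat.fib (k + 3) := Nat.fib_add_two
    have e6 : Nat.fib (k + 6) = Nat.fib (k + 4) + Nat.fib (k + 5) := Nat.fib_add_two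
    rw [show k + 1 + 5 = k + 6 by ring, show k + 1 + 3 = k + 4 by ring]
    zify at e4 e6
    linarith

lemma ftmDiff_eq_value {k n : ℕ} (h1 : Nat.fib (k + 5) ≤ n) (h2 : n < Nat.fib (k + 6)) :
    ftmDiff n = ftmDiffValue k n := by
  have hsum : ∑ n ∈ Finset.Ico (Nat.fib (k + 5)) (Nat.fib (k + 6)), ftmDiffValue k n =
      ∑ n ∈ Finset.Ico (Nat.fib (k + 5)) (Nat.fib (k + 6)), ftmDiff n := by
    have h5 := subwordComplexity_ftm_fib k
    have h6 := subwordComplexity_ftm_fib (k + 1)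
    have e4 : Nat.fib (k + 4) = Nat.fib (k + 2) + Nat.fib (k + 3) := Nat.fib_add_two
    have e6 : Nat.fib (k + 6) = Nat.fib (k + 4) + Nat.fib (k + 5) := Nat.fib_add_two
    rw [show k + 1 + 5 = k + 6 by ring, show k + 1 + 3 = k + 4 by ring] at h6
    rw [sum_ftmDiffValue, sum_ftmDiff (Nat.fib_mono (by omega))]
    zify at e4 e6
    linarith
  have := (Finset.sum_eq_sum_iff_of_le fun n hn =>
    ftmDiffValue_le (Finset.mem_Ico.1 hn).1).1 hsum n (Finset.mem_Ico.2 ⟨h1, h2⟩)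
  exact this.symm

lemma ftmDiff_initial : ftmDiff 0 = 1 ∧ ftmDiff 1 = 2 ∧ ftmDiff 2 = 4 ∧ ftmDiff 3 = 6 ∧
    ftmDiff 4 = 10 := by
  have h5 := subwordComplexity_ftm_five
  have hfib := subwordComplexity_ftm_fib 0
  have h0 := one_le_ftmDiff_zero
  have h1 := two_le_ftmDiff_one
  have h2 := four_le_ftmDiff_two
  have h3 := six_le_ftmDiff (n := 3) le_rfl
  have h4 := ten_le_ftmDiff_four
  have e5 : Nat.fib (0 + 5) = 5 := rfl
  have e3 : Nat.fib (0 + 3) = 2 := rfl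
  rw [e5, e3] at hfib
  push_cast at hfib
  omega

/-! ### The runs of `6` and `8` -/

lemma ftmDiff_eq_six {i n : ℕ} (hi : 2 ≤ i) (h1 : 2 * Nat.fib (i + 1) + 1 + i % 2 ≤ n)
    (h2 : n ≤ Nat.fib (i + 3) + (i + 1) % 2) : ftmDiff n = 6 := by
  obtain ⟨i, rfl⟩ := Nat.exists_eq_add_of_le' hi
  have hf : 1 ≤ Nat.fib (i + 2) := Nat.fib_pos.2 (by omega)
  have hf3 : 2 ≤ Nat.fib (i + 3) := two_le_fib (by omega)
  have hmono : Nat.fib (i + 2) ≤ Nat.fib (i + 3) := Nat.fib_le_fib_succ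
  have e4 : Nat.fib (i + 4) = Nat.fib (i + 2) + Nat.fib (i + 3) := Nat.fib_add_two
  have e5 : Nat.fib (i + 5) = Nat.fib (i + 3) + Nat.fib (i + 4) := Nat.fib_add_two
  have e6 : Nat.fib (i + 6) = Nat.fib (i + 4) + Nat.fib (i + 5) := Nat.fib_add_two
  simp only [Nat.add_assoc, Nat.reduceAdd] at h1 h2
  by_cases h : Nat.fib (i + 5) ≤ n
  · rw [ftmDiff_eq_value h (by omega), ftmDiffValue, if_neg (by omega)]
  · have hi0 : i ≠ 0 := by
      rintro rfl
      norm_num [Nat.fib] at h h1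
      omega
    obtain ⟨i, rfl⟩ := Nat.exists_eq_succ_of_ne_zero hi0
    simp only [Nat.succ_eq_add_one, Nat.add_assoc, Nat.reduceAdd] at *
    rw [ftmDiff_eq_value (k := i) (by omega) (by omega), ftmDiffValue, if_neg (by omega)]

lemma ftmDiff_eq_eight {i n : ℕ} (hi : 2 ≤ i) (h1 : Nat.fib (i + 3) + (i + 1) % 2 < n)
    (h2 : n ≤ 2 * Nat.fib (i + 2) + (i + 1) % 2) : ftmDiff n = 8 := by
  obtain ⟨i, rfl⟩ := Nat.exists_eq_add_of_le' hi
  have hf3 : 2 ≤ Nat.fib (i + 3) := two_le_fib (by omega)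
  have e5 : Nat.fib (i + 5) = Nat.fib (i + 3) + Nat.fib (i + 4) := Nat.fib_add_two
  have e6 : Nat.fib (i + 6) = Nat.fib (i + 4) + Nat.fib (i + 5) := Nat.fib_add_two
  simp only [Nat.add_assoc, Nat.reduceAdd] at h1 h2
  rw [ftmDiff_eq_value (k := i) (by omega) (by omega), ftmDiffValue, if_pos (by omega)]

lemma toNat_fib_add_neg_one_pow (i : ℕ) (hi : 2 ≤ i) :
    ((Nat.fib i : ℤ) + (-1) ^ i).toNat + 2 * (i % 2) = Nat.fib i + 1 := by
  have hf : 0 < Nat.fib i := Nat.fib_pos.2 (by omega)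
  rcases Nat.even_or_odd i with h | h
  · rw [h.neg_one_pow, Nat.even_iff.1 h]
    omega
  · rw [h.neg_one_pow, Nat.odd_iff.1 h]
    omega

lemma partialConcat_succ {α : Type*} (B : ℕ → List α) (k : ℕ) :
    partialConcat B (k + 1) = partialConcat B k ++ B k := by
  simp [partialConcat, List.range_succ]

lemma length_dekkingBlock {i : ℕ} (hi : 2 ≤ i) :
    2 * Nat.fib (i + 1) + 1 + i % 2 + (dekkingBlock i).length =
      2 * Nat.fib (i + 2) + 1 + (i + 1) % 2 := by
  have h := toNat_fib_add_neg_one_pow i hi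
  have e : Nat.fib (i + 2) = Nat.fib i + Nat.fib (i + 1) := Nat.fib_add_two
  rw [dekkingBlock, List.length_append, List.length_replicate, List.length_replicate]
  omega

lemma length_partialConcat_dekkingBlocks (k : ℕ) :
    (partialConcat dekkingBlocks (k + 1)).length = 2 * Nat.fib (k + 3) + 1 + k % 2 := by
  induction k with
  | zero => rfl
  | succ k ih =>
    have h := length_dekkingBlock (i := k + 2) (by omega)
    simp only [Nat.add_assoc, Nat.reduceAdd] at h
    rw [partialConcat_succ, List.length_append, ih]
    simp only [dekkingBlocks, Nat.add_assoc, Nat.reduceAdd]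
    omega

lemma map_ftmDiff_dekkingBlock {i : ℕ} (hi : 2 ≤ i) :
    (List.range (dekkingBlock i).length).map
      (fun t => ftmDiff (2 * Nat.fib (i + 1) + 1 + i % 2 + t)) = dekkingBlock i := by
  have h := toNat_fib_add_neg_one_pow i hi
  have e2 : Nat.fib (i + 2) = Nat.fib i + Nat.fib (i + 1) := Nat.fib_add_two
  have e3 : Nat.fib (i + 3) = Nat.fib (i + 1) + Nat.fib (i + 2) := Nat.fib_add_two
  rw [dekkingBlock, List.length_append, List.length_replicate, List.length_replicate,
    List.range_add, List.map_append]
  congr 1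
  · rw [List.eq_replicate_iff]
    refine ⟨by simp, fun b hb => ?_⟩
    simp only [List.mem_map, List.mem_range] at hb
    obtain ⟨t, ht, rfl⟩ := hb
    exact ftmDiff_eq_six hi (by omega) (by omega)
  · rw [List.eq_replicate_iff]
    refine ⟨by simp, fun b hb => ?_⟩
    simp only [List.mem_map, List.mem_range] at hb
    obtain ⟨_, ⟨t, ht, rfl⟩, rfl⟩ := hb
    exact ftmDiff_eq_eight hi (by omega) (by omega)

lemma map_ftmDiff_partialConcat (k : ℕ) :
    (List.range (partialConcat dekkingBlocks (k + 1)).length).map ftmDiff =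
      partialConcat dekkingBlocks (k + 1) := by
  induction k with
  | zero =>
    obtain ⟨h0, h1, h2, h3, h4⟩ := ftmDiff_initial
    simp [partialConcat, dekkingBlocks, List.range_succ, h0, h1, h2, h3, h4]
  | succ k ih =>
    have h := map_ftmDiff_dekkingBlock (i := k + 2) (by omega)
    have hlen := length_partialConcat_dekkingBlocks k
    rw [partialConcat_succ, List.length_append, List.range_add, List.map_append, ih]
    congr 1
    rw [hlen, List.map_map, dekkingBlocks]
    simpa only [Function.comp_def, Nat.add_assoc, Nat.reduceAdd, Nat.add_mod_right] using h

theorem corollary3 : IsInfiniteConcat ftmDiff dekkingBlocks := by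
  refine ⟨fun k => ?_, fun n => ⟨n + 3, ?_⟩⟩
  · cases k with
    | zero => rfl
    | succ k => exact map_ftmDiff_partialConcat k
  · have h := Nat.le_fib_self (n := n + 5) (by omega)
    rw [length_partialConcat_dekkingBlocks (n + 2)]
    simp only [Nat.add_assoc, Nat.reduceAdd]
    omega
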